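/- Consider the system $x(k+1)=Ax(k)+Bu(k)+w(k)$ with $x(k),w(k)\in\mathbb R^{n_x}$, $u(k)\in\mathbb R^{n_u}$, where the $w(k)$ are i.i.d. with distribution $\mathcal Q^w$, and the initial state $x(0)$ is known (deterministic). Let $\mathbb X\subseteq\mathbb R^{n_x}$, $\mathbb U\subseteq\mathbb R^{n_u}$ be convex sets containing the origin, $K\in\mathbb R^{n_u\times n_x}$ a feedback gain, and $A_K=A+BK$. Write $\mathcal A\ominus\mathcal B=\{a\in\mathcal A : a+b\in\mathcal A\ \forall b\in\mathcal B\}$ and $\|x\|_P^2=x^\top Px$. Assume that $\mathcal Q^w$ is central convex unimodal, i.e. it lies in the closed (with respect to weak convergence) convex hull of the set of uniform distributions on symmetric compact convex bodies in $\mathbb R^{n_x}$. Let $\mathcal R_x,\mathcal R_u\subseteq\mathbb R^{n_x}$ be (measurable) convex symmetric sets which are probabilistic reachable sets of probability levels $p_x$ and $p_u$, respectively, for the error system $e_{i+1}=A_Ke_i+w_i$ with i.i.d. $w_i\sim\mathcal Q^w$; that is, if $e_0=0$, then $\Pr(e_i\in\mathcal R_x)\ge p_x$ and $\Pr(e_i\in\mathcal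 R_u)\ge p_u$ for all $i\ge 0$. Put $\mathbb Z=\mathbb X\ominus\mathcal R_x$ and $\mathbb V=\mathbb U\ominus K\mathcal R_u$. Let $N\ge 1$ and $Q,Q_f,R\succ0$. For a given nominal state $z$, consider the nominal MPC problem $$\min_{z_0,\dots,z_N,\;v_0,\dots,v_{N-1}}\ \|z_N\|_{Q_f}^2+\sum_{i=0}^{N-1}\left(\|z_i\|_Q^2+\|v_i\|_R^2\right)$$ subject to $z_0=z$, $z_{i+1}=Az_i+Bv_i$, $z_i\in\mathbb Z$, $v_i\in\mathbb V$ for $i=0,\dots,N-1$, and $z_N\in\mathbb Z_f$. The terminal set satisfies $\mathbb Z_f\subseteq\mathbb Z$ and, for all $z\in\mathbb Z_f$: $A_Kz\in\mathbb Z_f$, $Kz\in\mathbb V$, and $\|A_Kz\|_{Q_f}^2-\|z\|_{Q_f}^2\le-\|z\|_Q^2-\|Kz\|_R^2$. Call $z$ feasible if the constraints can be satisfied. Assume that the set of feasible $z$ is measurable, that an optimal solution exists for every feasible $z$, and that the first element $v_0^*(z)$ of an optimal input sequence is chosen as a measurable function of $z$. Assume that the problem is feasible for $z(0)=x(0)$.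 The closed loop is defined by $z(0)=x(0)$, $v(k)=v_0^*(z(k))$, $e(k)=x(k)-z(k)$, $u(k)=v(k)+Ke(k)$, and the conditional update $$z(k+1)=\begin{cases}x(k+1)&\text{if } x(k+1) \text{ is feasible},\\ Az(k)+Bv(k)&\text{otherwise.}\end{cases}$$ Then, for all $k\ge0$, one has $z(k)\in\mathbb X\ominus\mathcal R_x$ and $v(k)\in\mathbb U\ominus K\mathcal R_u$ for every disturbance realization, and the closed-loop system satisfies the chance constraints $$\Pr(x(k)\in\mathbb X)\ge p_x,\qquad \Pr(u(k)\in\mathbb U)\ge p_u .$$ -/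

import Mathlib

open MeasureTheory ProbabilityTheory
open scoped NNReal Matrix

/-- A set is (centrally) symmetric if it is invariant under `x ↦ -x`. -/
def IsSymmetricSet {n : ℕ} (S : Set (Fin n → ℝ)) : Prop :=
  ∀ x ∈ S, -x ∈ S

/-- Symmetric compact convex bodies in `ℝⁿ`. -/
structure IsSymmetricConvexBody {n : ℕ} (C : Set (Fin n → ℝ)) : Prop where
  convex : Convex ℝ C
  symmetric : IsSymmetricSet C
  compact : IsCompact C
  interior_nonempty : (interior C).Nonempty

/-- The convex hull of the uniform distributions on symmetric compact convex bodies: all finite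
convex combinations of such distributions. `volume[|C]` is the normalised Lebesgue measure
on `C`. -/
def symmetricUniformHull (n : ℕ) : Set (ProbabilityMeasure (Fin n → ℝ)) :=
  {μ | ∃ (r : ℕ) (c : Fin r → ℝ≥0) (C : Fin r → Set (Fin n → ℝ)),
    (∀ j, IsSymmetricConvexBody (C j)) ∧ ∑ j, c j = 1 ∧
      (μ : Measure (Fin n → ℝ)) = ∑ j, c j • (volume : Measure (Fin n → ℝ))[|C j]}

/-- Central convex unimodality: membership in the closed convex hull of the uniform distributions on
symmetric compact convex bodies. The topology on `ProbabilityMeasure` is that of weak convergence. -/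
def IsCentralConvexUnimodal {n : ℕ} (D : ProbabilityMeasure (Fin n → ℝ)) : Prop :=
  D ∈ closure (symmetricUniformHull n)

/-- The trajectory of `e (i+1) = M e i + w i` started at `e 0 = 0`. -/
def linearError {n : ℕ} (M : Matrix (Fin n) (Fin n) ℝ) (w : ℕ → Fin n → ℝ) : ℕ → Fin n → ℝ
  | 0 => 0
  | i + 1 => M *ᵥ linearError M w i + w i

/-- `S` is a probabilistic reachable set of probability level `p` for `e (i+1) = M e i + w i` with
i.i.d. disturbances `w i ∼ D`; the disturbance sequence is realised on the canonical infinite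
product space. -/
def IsPRS {n : ℕ} (M : Matrix (Fin n) (Fin n) ℝ) (D : ProbabilityMeasure (Fin n → ℝ)) (p : ℝ)
    (S : Set (Fin n → ℝ)) : Prop :=
  ∀ i : ℕ, p ≤ (Measure.infinitePi fun _ : ℕ => (D : Measure (Fin n → ℝ))).real
    {w | linearError M w i ∈ S}

/-- The Pontryagin set difference `S ⊖ T`. -/
def pontryaginDiff {n : ℕ} (S T : Set (Fin n → ℝ)) : Set (Fin n → ℝ) :=
  {a ∈ S | ∀ b ∈ T, a + b ∈ S}

/-- The squared weighted norm `‖x‖_P² = xᵀ P x`. -/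
def wnormSq {n : ℕ} (P : Matrix (Fin n) (Fin n) ℝ) (x : Fin n → ℝ) : ℝ :=
  x ⬝ᵥ (P *ᵥ x)

/-- The data of the stochastic MPC scheme with state dimension `n` and input dimension `m`:
system matrices `A`, `B`, feedback gain `K`, weights `Q`, `Qf`, `R`, horizon `N`, constraint
sets `X`, `U`, terminal set `Zf`, and the sets `Rx`, `Ru` used for tightening. -/
structure SMPC (n m : ℕ) where
  A : Matrix (Fin n) (Fin n) ℝ
  B : Matrix (Fin n) (Fin m) ℝ
  K : Matrix (Fin m) (Fin n) ℝ
  Q : Matrix (Fin n) (Fin n) ℝ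
  Qf : Matrix (Fin n) (Fin n) ℝ
  R : Matrix (Fin m) (Fin m) ℝ
  N : ℕ
  X : Set (Fin n → ℝ)
  U : Set (Fin m → ℝ)
  Zf : Set (Fin n → ℝ)
  Rx : Set (Fin n → ℝ)
  Ru : Set (Fin n → ℝ)

namespace SMPC

variable {n m : ℕ} (S : SMPC n m)

/-- The closed-loop error matrix `A + BK`. -/
def AK : Matrix (Fin n) (Fin n) ℝ := S.A + S.B * S.K

/-- Tightened state constraint `X ⊖ Rx`. -/
def Z : Set (Fin n → ℝ) := pontryaginDiff S.X S.Rx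

/-- Tightened input constraint `U ⊖ K Ru`. -/
def V : Set (Fin m → ℝ) := pontryaginDiff S.U ((fun e => S.K *ᵥ e) '' S.Ru)

/-- The requirements on the terminal set: it is contained in the tightened state constraint set,
positively invariant under `v = K z`, satisfies the tightened input constraints under this law, and
the terminal cost decreases along it. -/
structure TerminalConditions : Prop where
  subset_Z : S.Zf ⊆ S.Z
  invariant : ∀ z ∈ S.Zf, S.A *ᵥ z + S.B *ᵥ (S.K *ᵥ z) ∈ S.Zf
  input_mem : ∀ z ∈ S.Zf, S.K *ᵥ z ∈ S.V
  decrease : ∀ z ∈ S.Zf,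
    wnormSq S.Qf (S.A *ᵥ z + S.B *ᵥ (S.K *ᵥ z)) - wnormSq S.Qf z
      ≤ -wnormSq S.Q z - wnormSq S.R (S.K *ᵥ z)

/-- `(zs, vs)` satisfies the constraints of the nominal MPC problem with initial state `z`.
Sequences are indexed by `ℕ` for convenience; only `zs 0, …, zs N` and `vs 0, …, vs (N-1)`
matter. -/
structure IsFeasible (z : Fin n → ℝ) (zs : ℕ → Fin n → ℝ) (vs : ℕ → Fin m → ℝ) : Prop where
  init : zs 0 = z
  dyn : ∀ i < S.N, zs (i + 1) = S.A *ᵥ zs i + S.B *ᵥ vs i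
  state_mem : ∀ i < S.N, zs i ∈ S.Z
  input_mem : ∀ i < S.N, vs i ∈ S.V
  terminal_mem : zs S.N ∈ S.Zf

/-- The cost of the nominal MPC problem. -/
def cost (zs : ℕ → Fin n → ℝ) (vs : ℕ → Fin m → ℝ) : ℝ :=
  wnormSq S.Qf (zs S.N) + ∑ i ∈ Finset.range S.N, (wnormSq S.Q (zs i) + wnormSq S.R (vs i))

/-- `(zs, vs)` is an optimal solution of the nominal MPC problem with initial state `z`. -/
def IsOptimal (z : Fin n → ℝ) (zs : ℕ → Fin n → ℝ) (vs : ℕ → Fin m → ℝ) : Prop :=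
  S.IsFeasible z zs vs ∧ ∀ zs' vs', S.IsFeasible z zs' vs' → S.cost zs vs ≤ S.cost zs' vs'

/-- The initial states for which the nominal MPC problem is feasible. -/
def feasibleSet : Set (Fin n → ℝ) := {z | ∃ zs vs, S.IsFeasible z zs vs}

/-- `v₀ z` is the first element of an optimal input sequence for every feasible `z`. -/
def IsMPCLaw (v₀ : (Fin n → ℝ) → Fin m → ℝ) : Prop :=
  ∀ z ∈ S.feasibleSet, ∃ zs vs, S.IsOptimal z zs vs ∧ v₀ z = vs 0

variable (v₀ : (Fin n → ℝ) → Fin m → ℝ) (x₀ : Fin n → ℝ) (w : ℕ → Fin n → ℝ)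

open Classical in
/-- The closed-loop pair `(x(k), z(k))` for the disturbance realisation `w`, started at
`x(0) = z(0) = x₀`: the input is `u(k) = v₀(z(k)) + K (x(k) - z(k))`, the successor state is
`x(k+1) = A x(k) + B u(k) + w(k)`, and `z(k+1)` is `x(k+1)` if that is feasible and otherwise
the nominal prediction `z₁(k) = A z(k) + B v₀(z(k))`. -/
noncomputable def closedLoop : ℕ → (Fin n → ℝ) × (Fin n → ℝ)
  | 0 => (x₀, x₀)
  | k + 1 =>
    let x := (closedLoop k).1
    let z := (closedLoop k).2
    let x' := S.A *ᵥ x + S.B *ᵥ (v₀ z + S.K *ᵥ (x - z)) + w k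
    (x', if x' ∈ S.feasibleSet then x' else S.A *ᵥ z + S.B *ᵥ v₀ z)

/-- Closed-loop state `x(k)`. -/
noncomputable def x (k : ℕ) : Fin n → ℝ := (S.closedLoop v₀ x₀ w k).1

/-- Nominal state `z(k)`. -/
noncomputable def z (k : ℕ) : Fin n → ℝ := (S.closedLoop v₀ x₀ w k).2

/-- Closed-loop error `e(k) = x(k) - z(k)`. -/
noncomputable def e (k : ℕ) : Fin n → ℝ := S.x v₀ x₀ w k - S.z v₀ x₀ w k

/-- Nominal input `v(k)`. -/
noncomputable def v (k : ℕ) : Fin m → ℝ := v₀ (S.z v₀ x₀ w k)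

/-- Applied input `u(k) = v(k) + K e(k)`. -/
noncomputable def u (k : ℕ) : Fin m → ℝ := S.v v₀ x₀ w k + S.K *ᵥ S.e v₀ x₀ w k

end SMPC

/-!
Membership of `z(k)` and `v(k)` in the tightened sets is recursive feasibility of the nominal
problem (`SMPC.IsFeasible.shift`): either `z(k+1)` is feasible by the definition of the update, or
it is the predicted state, from which the shifted solution is feasible. Since `x = z + e` and
`u = v + K e`, the chance constraints follow once `Pr(e(k) ∈ R) ≥ p` for every symmetric convex
probabilistic reachable set `R` of level `p`.

The closed-loop error obeys `e(k+1) = A_K e(k) + w(k)`, except that it is set to zero when the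
nominal state is updated, an event that depends on the past disturbances in an arbitrary way. Let
`f l y` be the probability that the recursion without updates, started at `y`, lies in `R` after
`l` steps. If `f l y ≤ f l 0` for all `y`, then
`E (f l (e (j+1))) ≥ E (f l (A_K e(j) + w(j))) = E (f (l+1) (e j))`, the equality because `w(j)` is
independent of `e(j)`. Chaining these inequalities from `j = 0` to `j = k` gives
`Pr(e(k) ∈ R) ≥ f k 0 ≥ p` (`IsPRS.le_measureReal_of_reset`).

It remains to prove Anderson's inequality `f l y ≤ f l 0`
(`IsCentralConvexUnimodal.iterate_stepOp_le_zero`). For uniform noise on a symmetric convex body,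
the Prékopa–Leindler inequality (`prekopaLeindler_midpoint`) shows that averaging
`y ↦ φ (M y + w)` over `w` keeps `φ` even and log-concave. Mixtures and weak limits of such noise
preserve the class of functions generated by even log-concave ones under convex combinations and
pointwise limits (`AndersonClass.stepOp`), and each member of this class is largest at the origin.
The indicator of the closure of a nonempty `R` is the decreasing limit of the log-concave functions
`max 0 (1 - k * dist(x, R))`.

This bounds `f l y` by the probability, from the origin, of the closure of `R`, while `R` itself
need not be closed and the noise need not have a density. For a uniform distribution `D` on a symmetric
body, `t ^ n * D (t⁻¹ S) ≤ D S` for `0 < t ≤ 1`. This passes to weak limits and to the `l`-step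
recursion, and as `t⁻¹ R` contains the closure of `R` for `t < 1`, letting `t → 1` shows that the
boundary of `R` carries no extra mass (`IsCentralConvexUnimodal.iterate_stepOp_closure_le`).
-/

/-! ### The Prékopa–Leindler inequality -/

/-- The one-dimensional Brunn–Minkowski inequality: a translate of `A` and a translate of `B` sit
inside `A + B` and meet in at most one point, the sum of the right end of `A` and the left end
of `B`. -/
lemma volume_add_volume_le_volume_add {A B : Set ℝ} (hA : IsCompact A) (hB : IsCompact B)
    (hA0 : A.Nonempty) (hB0 : B.Nonempty) {H : Set ℝ} (hH : ∀ x ∈ A, ∀ y ∈ B, x + y ∈ H) :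
    volume A + volume B ≤ volume H := by
  set a := sSup A
  set b := sInf B
  have ha : a ∈ A := hA.sSup_mem hA0
  have hb : b ∈ B := hB.sInf_mem hB0
  have h1 : volume ((fun x => x + b) '' A) = volume A := by simp
  have h2 : volume ((fun x => a + x) '' B) = volume B := by simp
  have hmeas : MeasurableSet ((fun x => a + x) '' B) :=
    (hB.image (by fun_prop)).isClosed.measurableSet
  rw [← h1, ← h2, ← measure_union₀ hmeas.nullMeasurableSet]
  · refine measure_mono (Set.union_subset ?_ ?_)
    · rintro _ ⟨x, hx, rfl⟩; exact hH x hx b hb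
    · rintro _ ⟨x, hx, rfl⟩; exact hH a ha x hx
  · refine measure_mono_null (t := {a + b}) ?_ (by simp)
    rintro _ ⟨⟨x, hx, rfl⟩, ⟨y, hy, hxy⟩⟩
    have hxa : x ≤ a := le_csSup hA.bddAbove hx
    have hyb : b ≤ y := csInf_le hB.bddBelow hy
    simp only [Set.mem_singleton_iff] at *
    linarith

open scoped Pointwise in
lemma volume_add_volume_le_two_mul_volume_midpoint {A B H : Set ℝ} (hA : MeasurableSet A)
    (hB : MeasurableSet B) (hA0 : A.Nonempty) (hB0 : B.Nonempty)
    (hH : ∀ x ∈ A, ∀ y ∈ B, (2⁻¹ : ℝ) • (x + y) ∈ H) :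
    volume A + volume B ≤ 2 * volume H := by
  have key : ∀ K ⊆ A, IsCompact K → ∀ L ⊆ B, IsCompact L → K.Nonempty → L.Nonempty →
      volume K + volume L ≤ 2 * volume H := by
    intro K hK hKc L hL hLc hK0 hL0
    have : volume ((2 : ℝ) • H) = 2 * volume H := by
      rw [Measure.addHaar_smul]; simp
    rw [← this]
    refine volume_add_volume_le_volume_add hKc hLc hK0 hL0 fun x hx y hy => ?_
    exact ⟨(2⁻¹ : ℝ) • (x + y), hH x (hK hx) y (hL hy), by simp⟩
  -- an empty compact subset is replaced by a point
  have key' : ∀ K ⊆ A, IsCompact K → ∀ L ⊆ B, IsCompact L →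
      volume K + volume L ≤ 2 * volume H := by
    obtain ⟨x, hx⟩ := hA0
    obtain ⟨y, hy⟩ := hB0
    intro K hK hKc L hL hLc
    refine le_trans (add_le_add (measure_mono (Set.subset_insert x K))
      (measure_mono (Set.subset_insert y L))) ?_
    exact key _ (Set.insert_subset hx hK) (hKc.insert x) _ (Set.insert_subset hy hL)
      (hLc.insert y) (Set.insert_nonempty _ _) (Set.insert_nonempty _ _)
  rw [hA.measure_eq_iSup_isCompact, hB.measure_eq_iSup_isCompact]
  simp only [iSup_and']
  refine ENNReal.biSup_add_biSup_le' ⟨∅, by simp⟩ ⟨∅, by simp⟩ ?_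
  exact fun K hK L hL => key' K hK.1 hK.2 L hL.1 hL.2

lemma lintegral_add_lintegral_le_of_iSup_eq_one {f g h : ℝ → ENNReal} (hf : Measurable f)
    (hg : Measurable g) (hh : Measurable h) (hf1 : ⨆ x, f x = 1) (hg1 : ⨆ x, g x = 1)
    (H : ∀ x y, f x * g y ≤ h ((2⁻¹ : ℝ) • (x + y)) ^ 2) :
    (∫⁻ x, f x) + (∫⁻ x, g x) ≤ 2 * ∫⁻ x, h x := by
  have layer : ∀ f : ℝ → ENNReal, Measurable f → (∀ x, f x ≤ 1) →
      ∫⁻ x, f x = ∫⁻ t in Set.Ioi (0 : ℝ), volume {x | ENNReal.ofReal t < f x} := by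
    intro f hf hf1
    have hfin : ∀ x, f x ≠ ⊤ := fun x => ((hf1 x).trans_lt ENNReal.one_lt_top).ne
    have := lintegral_eq_lintegral_meas_lt volume (f := fun x => (f x).toReal)
      (ae_of_all _ fun x => ENNReal.toReal_nonneg) hf.ennreal_toReal.aemeasurable
    simp only [ENNReal.ofReal_toReal (hfin _)] at this
    rw [this]
    refine setLIntegral_congr_fun measurableSet_Ioi fun t ht => ?_
    congr 1
    ext x
    simp only [Set.mem_ofPred_eq]
    rw [ENNReal.ofReal_lt_iff_lt_toReal (le_of_lt ht) (hfin x)]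
  have hmeas : ∀ f : ℝ → ENNReal, Measurable fun t : ℝ => volume {x | ENNReal.ofReal t < f x} := by
    intro f
    refine Antitone.measurable fun s t hst => measure_mono fun x hx => ?_
    exact (ENNReal.ofReal_le_ofReal hst).trans_lt hx
  have hle : ∫⁻ x, min (h x) 1 ≤ ∫⁻ x, h x := lintegral_mono fun x => min_le_left _ _
  refine le_trans ?_ (mul_le_mul_right hle 2)
  rw [layer f hf (fun x => hf1 ▸ le_iSup f x), layer g hg (fun x => hg1 ▸ le_iSup g x),
    layer _ (hh.min measurable_const) (fun x => min_le_right _ _),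
    ← lintegral_add_left (hmeas f), ← lintegral_const_mul _ (hmeas _)]
  refine lintegral_mono fun t => ?_
  rcases lt_or_ge (ENNReal.ofReal t) 1 with ht | ht
  · refine volume_add_volume_le_two_mul_volume_midpoint (measurableSet_lt measurable_const hf)
      (measurableSet_lt measurable_const hg) ?_ ?_ ?_
    · exact lt_iSup_iff.1 (hf1 ▸ ht)
    · exact lt_iSup_iff.1 (hg1 ▸ ht)
    · intro x hx y hy
      refine lt_min ?_ ht
      by_contra! hc
      have h1 := (H x y).trans (pow_le_pow_left₀ zero_le hc 2)
      have h2 := ENNReal.mul_lt_mul hx hy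
      rw [← sq] at h2
      exact absurd h1 (not_le.2 h2)
  · have hz : ∀ f : ℝ → ENNReal, ⨆ x, f x = 1 → {x | ENNReal.ofReal t < f x} = ∅ := by
      intro f hf
      ext x
      simpa using (le_iSup f x).trans (hf.le.trans ht)
    simp only [hz f hf1, hz g hg1, measure_empty, add_zero, zero_le]

/-- The arithmetic-geometric mean inequality in `ℝ≥0∞`. -/
lemma ENNReal.four_mul_mul_le_add_sq (a b : ENNReal) : 4 * (a * b) ≤ (a + b) ^ 2 := by
  by_cases ha : a = ⊤
  · simp [ha]
  by_cases hb : b = ⊤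
  · simp [hb]
  lift a to ℝ≥0 using ha
  lift b to ℝ≥0 using hb
  norm_cast
  rw [← NNReal.coe_le_coe]
  push_cast
  nlinarith [sq_nonneg ((a : ℝ) - b)]

/-- The one-dimensional Prékopa–Leindler inequality for functions with finite suprema, by scaling
both suprema to one. -/
lemma prekopaLeindler_real_of_iSup_ne_top {f g h : ℝ → ENNReal} (hf : Measurable f)
    (hg : Measurable g) (hh : Measurable h) (hfT : ⨆ x, f x ≠ ⊤) (hgT : ⨆ x, g x ≠ ⊤)
    (H : ∀ x y, f x * g y ≤ h ((2⁻¹ : ℝ) • (x + y)) ^ 2) :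
    (∫⁻ x, f x) * ∫⁻ x, g x ≤ (∫⁻ x, h x) ^ 2 := by
  set F := ⨆ x, f x with hF
  set G := ⨆ x, g x with hG
  by_cases hF0 : F = 0
  · have : f = 0 := funext fun x => le_antisymm ((le_iSup f x).trans hF0.le) zero_le
    simp [this]
  by_cases hG0 : G = 0
  · have : g = 0 := funext fun x => le_antisymm ((le_iSup g x).trans hG0.le) zero_le
    simp [this]
  obtain ⟨c, hc⟩ : ∃ c : ENNReal, c ^ 2 = F * G := by
    refine ⟨(F * G) ^ (1 / 2 : ℝ), ?_⟩
    rw [← ENNReal.rpow_natCast, ← ENNReal.rpow_mul]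
    norm_num
  have hc0 : c ≠ 0 := by
    rintro rfl
    simp [hF0, hG0] at hc
  have hcT : c ≠ ⊤ := by
    rintro rfl
    exact ENNReal.mul_ne_top hfT hgT (by rw [← hc]; simp)
  have hinv : F⁻¹ * G⁻¹ = c⁻¹ ^ 2 := by
    rw [← ENNReal.inv_pow, hc, ENNReal.mul_inv (Or.inl hF0) (Or.inl hfT)]
  have h1 := lintegral_add_lintegral_le_of_iSup_eq_one (f := fun x => F⁻¹ * f x)
    (g := fun x => G⁻¹ * g x) (h := fun x => c⁻¹ * h x) (hf.const_mul _) (hg.const_mul _)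
    (hh.const_mul _) (by rw [← ENNReal.mul_iSup, ← hF, ENNReal.inv_mul_cancel hF0 hfT])
    (by rw [← ENNReal.mul_iSup, ← hG, ENNReal.inv_mul_cancel hG0 hgT]) (by
      intro x y
      rw [mul_mul_mul_comm, hinv, mul_pow]
      exact mul_le_mul_right (H x y) _)
  rw [lintegral_const_mul _ hf, lintegral_const_mul _ hg, lintegral_const_mul _ hh] at h1
  have h2 := (ENNReal.four_mul_mul_le_add_sq _ _).trans (pow_le_pow_left₀ zero_le h1 2)
  rw [mul_mul_mul_comm, hinv, mul_pow, mul_pow, show (2 : ENNReal) ^ 2 = 4 by norm_num] at h2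
  rw [ENNReal.mul_le_mul_iff_right (by norm_num) (by norm_num),
    ENNReal.mul_le_mul_iff_right (by simp [hcT]) (by simp [hc0])] at h2
  exact h2

lemma prekopaLeindler_real {f g h : ℝ → ENNReal} (hf : Measurable f)
    (hg : Measurable g) (hh : Measurable h)
    (H : ∀ x y, f x * g y ≤ h ((2⁻¹ : ℝ) • (x + y)) ^ 2) :
    (∫⁻ x, f x) * ∫⁻ x, g x ≤ (∫⁻ x, h x) ^ 2 := by
  -- truncation at height `k`, then monotone convergence
  have htrunc : ∀ f : ℝ → ENNReal, Measurable f →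
      Filter.Tendsto (fun k : ℕ => ∫⁻ x, min (f x) k) Filter.atTop (nhds (∫⁻ x, f x)) := by
    intro f hf
    refine lintegral_tendsto_of_tendsto_of_monotone
      (fun k => (hf.min measurable_const).aemeasurable)
      (ae_of_all _ fun x k l hkl => min_le_min_left _ (by exact_mod_cast hkl))
      (ae_of_all _ fun x => ?_)
    simpa using (tendsto_const_nhds (x := f x)).min ENNReal.tendsto_nat_nhds_top
  have hk : ∀ k l : ℕ, (∫⁻ x, min (f x) k) * ∫⁻ x, min (g x) l ≤ (∫⁻ x, h x) ^ 2 := by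
    intro k l
    refine prekopaLeindler_real_of_iSup_ne_top (hf.min measurable_const) (hg.min measurable_const)
      hh ?_ ?_ fun x y => le_trans (mul_le_mul' (min_le_left _ _) (min_le_left _ _)) (H x y)
    · exact ne_top_of_le_ne_top (ENNReal.natCast_ne_top k) (iSup_le fun x => min_le_right _ _)
    · exact ne_top_of_le_ne_top (ENNReal.natCast_ne_top l) (iSup_le fun x => min_le_right _ _)
  have hsup : ∀ f : ℝ → ENNReal, Measurable f → ⨆ k : ℕ, (∫⁻ x, min (f x) k) = ∫⁻ x, f x :=
    fun f hf => iSup_eq_of_tendsto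
      (fun k l hkl => lintegral_mono fun x => min_le_min_left _ (by exact_mod_cast hkl))
      (htrunc f hf)
  rw [← hsup f hf, ← hsup g hg, ENNReal.iSup_mul]
  refine iSup_le fun k => ?_
  rw [ENNReal.mul_iSup]
  exact iSup_le fun l => hk k l

/-- The Prékopa–Leindler inequality for midpoints. -/
theorem prekopaLeindler_midpoint {n : ℕ} {f g h : (Fin n → ℝ) → ENNReal} (hf : Measurable f)
    (hg : Measurable g) (hh : Measurable h)
    (H : ∀ x y, f x * g y ≤ h ((2⁻¹ : ℝ) • (x + y)) ^ 2) :
    (∫⁻ x, f x) * ∫⁻ x, g x ≤ (∫⁻ x, h x) ^ 2 := by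
  induction n with
  | zero =>
    have : ∀ f : (Fin 0 → ℝ) → ENNReal, ∫⁻ x, f x = f 0 := by
      intro f
      rw [lintegral_unique, volume_pi, Measure.pi_univ]
      simpa using congrArg f (Subsingleton.elim _ _)
    simpa [this] using H 0 0
  | succ n ih =>
    have hφ := (volume_preserving_piFinSuccAbove (fun _ : Fin (n + 1) => ℝ) 0).symm
    have hsplit : ∀ f : (Fin (n + 1) → ℝ) → ENNReal, Measurable f →
        ∫⁻ x, f x = ∫⁻ a : ℝ, ∫⁻ b : Fin n → ℝ, f (Fin.cons a b) := by
      intro f hf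
      rw [← hφ.lintegral_comp hf, Measure.volume_eq_prod, lintegral_prod]
      · simp [MeasurableEquiv.piFinSuccAbove, Fin.consEquiv]
      · exact (hf.comp hφ.measurable).aemeasurable
    have hcons : Measurable fun p : ℝ × (Fin n → ℝ) => (Fin.cons p.1 p.2 : Fin (n + 1) → ℝ) := by
      rw [measurable_pi_iff]
      intro i
      refine Fin.cases ?_ (fun j => ?_) i
      · simpa using measurable_fst
      · simpa [Function.comp_def] using (measurable_pi_apply j).comp measurable_snd
    have hmarg : ∀ f : (Fin (n + 1) → ℝ) → ENNReal, Measurable f →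
        Measurable fun a : ℝ => ∫⁻ b : Fin n → ℝ, f (Fin.cons a b) :=
      fun f hf => (hf.comp hcons).lintegral_prod_right'
    rw [hsplit f hf, hsplit g hg, hsplit h hh]
    refine prekopaLeindler_real (hmarg f hf) (hmarg g hg) (hmarg h hh) fun a a' => ?_
    have hsec : ∀ (a : ℝ), Measurable fun b : Fin n → ℝ => (Fin.cons a b : Fin (n + 1) → ℝ) :=
      fun a => hcons.comp measurable_prodMk_left
    refine ih (hf.comp (hsec a)) (hg.comp (hsec a')) (hh.comp (hsec _)) fun x y => ?_
    have := H (Fin.cons a x) (Fin.cons a' y)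
    convert this using 3
    ext i
    refine Fin.cases ?_ (fun j => ?_) i <;> simp [mul_add]

/-! ### Functions that are largest at the origin -/

/-- One backward step of the linear recursion `y ↦ M y + w`, `w ∼ D`: the expectation of `φ` after
the step, as a function of the state before it. -/
noncomputable def stepOp {n : ℕ} (M : Matrix (Fin n) (Fin n) ℝ) (D : Measure (Fin n → ℝ))
    (φ : (Fin n → ℝ) → ℝ) (y : Fin n → ℝ) : ℝ :=
  ∫ w, φ (M *ᵥ y + w) ∂D

/-- Lipschitz functions with values in `[0, 1]`. -/
structure IsLipUnit {n : ℕ} (φ : (Fin n → ℝ) → ℝ) : Prop where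
  lip : ∃ K, LipschitzWith K φ
  nonneg : ∀ x, 0 ≤ φ x
  le_one : ∀ x, φ x ≤ 1

/-- The smallest class of functions that contains the even, midpoint log-concave ones and is closed
under convex combinations and pointwise limits of sequences (all functions being Lipschitz
with values in `[0, 1]`). Every step operator of a central convex unimodal distribution preserves
it, and its members are largest at the origin. Log-concave functions alone would not do: they are
not closed under mixtures. -/
inductive AndersonClass {n : ℕ} : ((Fin n → ℝ) → ℝ) → Prop
  | base {φ : (Fin n → ℝ) → ℝ} (hφ : IsLipUnit φ) (even : ∀ x, φ (-x) = φ x)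
      (mid : ∀ x y, φ x * φ y ≤ φ ((2⁻¹ : ℝ) • (x + y)) ^ 2) : AndersonClass φ
  | sum {r : ℕ} (c : Fin r → ℝ≥0) (φ : Fin r → (Fin n → ℝ) → ℝ) (hc : ∑ j, c j = 1)
      (hφ : ∀ j, AndersonClass (φ j)) : AndersonClass fun x => ∑ j, (c j : ℝ) * φ j x
  | lim (φ : ℕ → (Fin n → ℝ) → ℝ) {ψ : (Fin n → ℝ) → ℝ} (hφ : ∀ k, AndersonClass (φ k))
      (hlim : ∀ x, Filter.Tendsto (fun k => φ k x) Filter.atTop (nhds (ψ x)))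
      (hψ : IsLipUnit ψ) : AndersonClass ψ

section

variable {n : ℕ} {φ : (Fin n → ℝ) → ℝ}

lemma IsLipUnit.continuous (hφ : IsLipUnit φ) : Continuous φ :=
  hφ.lip.choose_spec.continuous

lemma integrable_of_unit_bounds {Ω : Type*} [MeasurableSpace Ω] {μ : Measure Ω} [IsFiniteMeasure μ]
    {f : Ω → ℝ} (hf : Measurable f) (h0 : ∀ x, 0 ≤ f x) (h1 : ∀ x, f x ≤ 1) :
    Integrable f μ :=
  Integrable.of_bound hf.aestronglyMeasurable 1 (ae_of_all _ fun x => by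
    rw [Real.norm_of_nonneg (h0 x)]; exact h1 x)

lemma integral_mem_unit {Ω : Type*} [MeasurableSpace Ω] {μ : Measure Ω} [IsProbabilityMeasure μ]
    {f : Ω → ℝ} (hf : Measurable f) (h0 : ∀ x, 0 ≤ f x) (h1 : ∀ x, f x ≤ 1) :
    0 ≤ ∫ x, f x ∂μ ∧ ∫ x, f x ∂μ ≤ 1 := by
  refine ⟨integral_nonneg h0, ?_⟩
  calc ∫ x, f x ∂μ ≤ ∫ _, (1 : ℝ) ∂μ :=
        integral_mono (integrable_of_unit_bounds hf h0 h1) (integrable_const _) h1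
    _ = 1 := by simp

lemma IsLipUnit.sum {r : ℕ} (c : Fin r → ℝ≥0) (φ : Fin r → (Fin n → ℝ) → ℝ) (hc : ∑ j, c j = 1)
    (hφ : ∀ j, IsLipUnit (φ j)) : IsLipUnit fun x => ∑ j, (c j : ℝ) * φ j x where
  lip := by
    choose K hK using fun j => (hφ j).lip
    refine ⟨∑ j, c j * K j, LipschitzWith.of_dist_le_mul fun x y => ?_⟩
    refine (dist_sum_sum_le _ _ _).trans ?_
    push_cast
    rw [Finset.sum_mul]
    refine Finset.sum_le_sum fun j _ => ?_
    rw [Real.dist_eq, ← mul_sub, abs_mul, NNReal.abs_eq, mul_assoc]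
    exact mul_le_mul_of_nonneg_left ((hK j).dist_le_mul x y) (c j).2
  nonneg x := Finset.sum_nonneg fun j _ => mul_nonneg (c j).2 ((hφ j).nonneg x)
  le_one x := by
    calc ∑ j, (c j : ℝ) * φ j x ≤ ∑ j, (c j : ℝ) :=
          Finset.sum_le_sum fun j _ => mul_le_of_le_one_right (c j).2 ((hφ j).le_one x)
      _ = 1 := by exact_mod_cast hc

lemma AndersonClass.isLipUnit (hφ : AndersonClass φ) : IsLipUnit φ := by
  induction hφ with
  | base hφ _ _ => exact hφ
  | sum c φ hc _ ih => exact IsLipUnit.sum c φ hc ih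
  | lim _ _ _ hψ _ => exact hψ

lemma AndersonClass.le_zero (hφ : AndersonClass φ) (y : Fin n → ℝ) : φ y ≤ φ 0 := by
  induction hφ with
  | base hφ even mid =>
    have := mid y (-y)
    rw [even, add_neg_cancel, smul_zero, ← sq] at this
    exact (sq_le_sq₀ (hφ.nonneg _) (hφ.nonneg _)).1 this
  | sum c φ hc _ ih => exact Finset.sum_le_sum fun j _ => mul_le_mul_of_nonneg_left (ih j) (c j).2
  | lim φ _ hlim _ ih => exact le_of_tendsto_of_tendsto' (hlim y) (hlim 0) ih

variable (M : Matrix (Fin n) (Fin n) ℝ) (D : Measure (Fin n → ℝ)) [IsProbabilityMeasure D]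

lemma continuous_mulVec_add : Continuous fun p : (Fin n → ℝ) × (Fin n → ℝ) => M *ᵥ p.1 + p.2 := by
  have := (Matrix.mulVecLin M).continuous_of_finiteDimensional
  exact (this.comp continuous_fst).add continuous_snd

lemma measurable_section {φ : (Fin n → ℝ) → ℝ} (hφ : Measurable φ) (y : Fin n → ℝ) :
    Measurable fun w => φ (M *ᵥ y + w) :=
  hφ.comp (measurable_const_add _)

lemma IsLipUnit.stepOp (hφ : IsLipUnit φ) : IsLipUnit (stepOp M D φ) where
  lip := by
    obtain ⟨K, hK⟩ := hφ.lip
    set L := (Matrix.mulVecLin M).toContinuousLinearMap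
    have hint : ∀ y, Integrable (fun w => φ (M *ᵥ y + w)) D := fun y =>
      integrable_of_unit_bounds (measurable_section M hφ.continuous.measurable y)
        (fun _ => hφ.nonneg _) (fun _ => hφ.le_one _)
    refine ⟨K * ‖L‖₊, LipschitzWith.of_dist_le_mul fun x y => ?_⟩
    rw [dist_eq_norm]
    simp only [_root_.stepOp]
    rw [← integral_sub (hint x) (hint y)]
    refine (norm_integral_le_of_norm_le_const (C := K * ‖L‖₊ * dist x y)
      (ae_of_all _ fun w => ?_)).trans (by simp)
    rw [← dist_eq_norm]
    refine (hK.dist_le_mul _ _).trans ?_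
    rw [mul_assoc, dist_add_right]
    exact mul_le_mul_of_nonneg_left (L.lipschitz.dist_le_mul x y) K.2
  nonneg y := (integral_mem_unit (measurable_section M hφ.continuous.measurable y)
    (fun _ => hφ.nonneg _) (fun _ => hφ.le_one _)).1
  le_one y := (integral_mem_unit (measurable_section M hφ.continuous.measurable y)
    (fun _ => hφ.nonneg _) (fun _ => hφ.le_one _)).2

lemma tendsto_stepOp {φ : ℕ → (Fin n → ℝ) → ℝ} {ψ : (Fin n → ℝ) → ℝ}
    (hφm : ∀ k, Measurable (φ k)) (h0 : ∀ k x, 0 ≤ φ k x) (h1 : ∀ k x, φ k x ≤ 1)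
    (hlim : ∀ x, Filter.Tendsto (fun k => φ k x) Filter.atTop (nhds (ψ x))) (y : Fin n → ℝ) :
    Filter.Tendsto (fun k => stepOp M D (φ k) y) Filter.atTop (nhds (stepOp M D ψ y)) := by
  refine tendsto_integral_of_dominated_convergence (fun _ => 1)
    (fun k => (measurable_section M (hφm k) y).aestronglyMeasurable) (integrable_const _)
    (fun k => ae_of_all _ fun w => ?_) (ae_of_all _ fun w => hlim _)
  rw [Real.norm_of_nonneg (h0 _ _)]
  exact h1 _ _

lemma stepOp_sum {r : ℕ} (c : Fin r → ℝ≥0) {φ : Fin r → (Fin n → ℝ) → ℝ}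
    (hφ : ∀ j, IsLipUnit (φ j)) :
    stepOp M D (fun x => ∑ j, (c j : ℝ) * φ j x)
      = fun y => ∑ j, (c j : ℝ) * stepOp M D (φ j) y := by
  ext y
  simp only [stepOp]
  rw [integral_finsetSum]
  · simp_rw [integral_const_mul]
  · exact fun j _ => (integrable_of_unit_bounds
      (measurable_section M (hφ j).continuous.measurable y)
        (fun _ => (hφ j).nonneg _) (fun _ => (hφ j).le_one _)).const_mul _

end

section

variable {n : ℕ} {C : Set (Fin n → ℝ)}

lemma IsSymmetricConvexBody.measurableSet (hC : IsSymmetricConvexBody C) : MeasurableSet C :=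
  hC.compact.isClosed.measurableSet

lemma IsSymmetricConvexBody.volume_ne_zero (hC : IsSymmetricConvexBody C) : volume C ≠ 0 :=
  (Measure.measure_pos_of_nonempty_interior _ hC.interior_nonempty).ne'

lemma IsSymmetricConvexBody.isProbabilityMeasure (hC : IsSymmetricConvexBody C) :
    IsProbabilityMeasure ((volume : Measure (Fin n → ℝ))[|C]) :=
  cond_isProbabilityMeasure_of_finite hC.volume_ne_zero hC.compact.measure_lt_top.ne

/-- A uniform distribution on a symmetric body is invariant under reflection. -/
lemma IsSymmetricConvexBody.integral_neg (hC : IsSymmetricConvexBody C) (f : (Fin n → ℝ) → ℝ) :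
    ∫ w, f (-w) ∂(volume : Measure (Fin n → ℝ))[|C]
      = ∫ w, f w ∂(volume : Measure (Fin n → ℝ))[|C] := by
  simp only [ProbabilityTheory.cond, integral_smul_measure]
  congr 1
  rw [← integral_indicator hC.measurableSet, ← integral_indicator hC.measurableSet,
    ← integral_neg_eq_self (C.indicator f)]
  congr 1
  ext w
  have : -w ∈ C ↔ w ∈ C := ⟨fun h => by simpa using hC.symmetric _ h, hC.symmetric _⟩
  by_cases hw : w ∈ C
  · simp [hw, this]
  · simp [hw, this]

lemma IsSymmetricConvexBody.prekopaLeindler (hC : IsSymmetricConvexBody C)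
    {f g h : (Fin n → ℝ) → ENNReal} (hf : Measurable f) (hg : Measurable g) (hh : Measurable h)
    (H : ∀ x y, f x * g y ≤ h ((2⁻¹ : ℝ) • (x + y)) ^ 2) :
    (∫⁻ x, f x ∂(volume : Measure (Fin n → ℝ))[|C]) * ∫⁻ x, g x ∂(volume : Measure (Fin n → ℝ))[|C]
      ≤ (∫⁻ x, h x ∂(volume : Measure (Fin n → ℝ))[|C]) ^ 2 := by
  have hCm := hC.measurableSet
  simp only [ProbabilityTheory.cond, lintegral_smul_measure, smul_eq_mul]
  rw [mul_mul_mul_comm, mul_pow, ← sq]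
  refine mul_le_mul_right ?_ _
  rw [← lintegral_indicator hCm, ← lintegral_indicator hCm, ← lintegral_indicator hCm]
  refine prekopaLeindler_midpoint (hf.indicator hCm) (hg.indicator hCm) (hh.indicator hCm) ?_
  intro x y
  by_cases hx : x ∈ C
  · by_cases hy : y ∈ C
    · have hxy : (2⁻¹ : ℝ) • (x + y) ∈ C := by
        rw [smul_add]
        exact hC.convex hx hy (by norm_num) (by norm_num) (by norm_num)
      rw [Set.indicator_of_mem hx, Set.indicator_of_mem hy, Set.indicator_of_mem hxy]
      exact H x y
    · simp [hy]
  · simp [hx]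

lemma AndersonClass.stepOp_uniform (M : Matrix (Fin n) (Fin n) ℝ) (hC : IsSymmetricConvexBody C)
    {φ : (Fin n → ℝ) → ℝ} (hφ : AndersonClass φ) :
    AndersonClass (stepOp M ((volume : Measure (Fin n → ℝ))[|C]) φ) := by
  have := hC.isProbabilityMeasure
  induction hφ with
  | @base φ hφ even mid =>
    refine .base (hφ.stepOp M _) (fun x => ?_) (fun x y => ?_)
    · simp only [stepOp]
      rw [← hC.integral_neg]
      congr 1
      ext w
      rw [Matrix.mulVec_neg, ← neg_add, even]
    · have hm : ∀ x, Measurable fun w => ENNReal.ofReal (φ (M *ᵥ x + w)) := fun x =>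
        (measurable_section M hφ.continuous.measurable x).ennreal_ofReal
      have hpl := hC.prekopaLeindler (hm x) (hm y) (hm ((2⁻¹ : ℝ) • (x + y))) fun w w' => by
        rw [← ENNReal.ofReal_mul (hφ.nonneg _), ← ENNReal.ofReal_pow (hφ.nonneg _)]
        refine ENNReal.ofReal_le_ofReal ((mid _ _).trans_eq ?_)
        congr 2
        rw [Matrix.mulVec_smul, Matrix.mulVec_add]
        module
      have hlin : ∀ x, ∫⁻ w, ENNReal.ofReal (φ (M *ᵥ x + w)) ∂(volume : Measure (Fin n → ℝ))[|C]
          = ENNReal.ofReal (stepOp M ((volume : Measure (Fin n → ℝ))[|C]) φ x) := fun x =>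
        (ofReal_integral_eq_lintegral_ofReal (integrable_of_unit_bounds
          (measurable_section M hφ.continuous.measurable x)
          (fun _ => hφ.nonneg _) (fun _ => hφ.le_one _)) (ae_of_all _ fun _ => hφ.nonneg _)).symm
      have h0 := (hφ.stepOp M ((volume : Measure (Fin n → ℝ))[|C])).nonneg
      rw [hlin, hlin, hlin, ← ENNReal.ofReal_mul (h0 _), ← ENNReal.ofReal_pow (h0 _)] at hpl
      exact (ENNReal.ofReal_le_ofReal_iff (pow_nonneg (h0 _) 2)).1 hpl
  | sum c φ hc hφ ih =>
    rw [stepOp_sum M _ c fun j => (hφ j).isLipUnit]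
    exact .sum c _ hc ih
  | lim φ hφ hlim hψ ih =>
    exact .lim _ ih (tendsto_stepOp M _ (fun k => (hφ k).isLipUnit.continuous.measurable)
      (fun k => (hφ k).isLipUnit.nonneg) (fun k => (hφ k).isLipUnit.le_one) hlim) (hψ.stepOp M _)

end

section

variable {n : ℕ}

lemma AndersonClass.stepOp_hull (M : Matrix (Fin n) (Fin n) ℝ)
    {D : ProbabilityMeasure (Fin n → ℝ)} (hD : D ∈ symmetricUniformHull n)
    {φ : (Fin n → ℝ) → ℝ} (hφ : AndersonClass φ) : AndersonClass (stepOp M D φ) := by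
  obtain ⟨r, c, C, hC, hc, hDc⟩ := hD
  have : stepOp M D φ
      = fun y => ∑ j, (c j : ℝ) * stepOp M ((volume : Measure (Fin n → ℝ))[|C j]) φ y := by
    ext y
    simp only [stepOp]
    rw [hDc, integral_finsetSum_measure]
    · simp only [integral_smul_nnreal_measure, NNReal.smul_def, smul_eq_mul]
    · intro j _
      have := (hC j).isProbabilityMeasure
      exact (integrable_of_unit_bounds (measurable_section M hφ.isLipUnit.continuous.measurable y)
        (fun _ => hφ.isLipUnit.nonneg _) (fun _ => hφ.isLipUnit.le_one _)).smul_measure_nnreal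
  rw [this]
  exact .sum c _ hc fun j => hφ.stepOp_uniform M (hC j)

/-- Weak limits are limits of sequences, since the weak topology is metrizable. -/
lemma IsCentralConvexUnimodal.exists_seq {D : ProbabilityMeasure (Fin n → ℝ)}
    (hD : IsCentralConvexUnimodal D) : ∃ Ds : ℕ → ProbabilityMeasure (Fin n → ℝ),
      (∀ k, Ds k ∈ symmetricUniformHull n) ∧ Filter.Tendsto Ds Filter.atTop (nhds D) :=
  mem_closure_iff_seq_limit.1 hD

/-- A form of Anderson's theorem: central convex unimodal noise preserves `AndersonClass`. -/
theorem AndersonClass.stepOp (M : Matrix (Fin n) (Fin n) ℝ)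
    {D : ProbabilityMeasure (Fin n → ℝ)} (hD : IsCentralConvexUnimodal D)
    {φ : (Fin n → ℝ) → ℝ} (hφ : AndersonClass φ) : AndersonClass (stepOp M D φ) := by
  obtain ⟨Ds, hDs, hlim⟩ := hD.exists_seq
  refine .lim _ (fun k => hφ.stepOp_hull M (hDs k)) (fun y => ?_) (hφ.isLipUnit.stepOp M _)
  have hc : Continuous fun w => φ (M *ᵥ y + w) :=
    hφ.isLipUnit.continuous.comp (continuous_const_add _)
  exact ProbabilityMeasure.tendsto_iff_forall_integral_tendsto.1 hlim
    (BoundedContinuousFunction.ofNormedAddCommGroup _ hc 1 fun w => by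
      rw [Real.norm_of_nonneg (hφ.isLipUnit.nonneg _)]; exact hφ.isLipUnit.le_one _)

end

/-! ### Dilations of central convex unimodal distributions -/

section

variable {n : ℕ}

lemma IsSymmetricConvexBody.zero_mem {C : Set (Fin n → ℝ)} (hC : IsSymmetricConvexBody C) :
    0 ∈ C := by
  obtain ⟨x, hx⟩ := hC.interior_nonempty.mono interior_subset
  have := hC.convex hx (hC.symmetric x hx) (a := 2⁻¹) (b := 2⁻¹) (by norm_num) (by norm_num)
    (by norm_num)
  simpa using this

/-- Shrinking a body into itself shows that uniform distributions on symmetric convex bodies charge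
the dilated set `t⁻¹ S` at most `t⁻ⁿ` times as much as `S`. -/
lemma IsSymmetricConvexBody.mul_cond_preimage_smul_le {C : Set (Fin n → ℝ)}
    (hC : IsSymmetricConvexBody C) {t : ℝ} (ht0 : 0 < t) (ht1 : t ≤ 1) (S : Set (Fin n → ℝ)) :
    ENNReal.ofReal (t ^ n) * (volume : Measure (Fin n → ℝ))[|C] {w | t • w ∈ S}
      ≤ (volume : Measure (Fin n → ℝ))[|C] S := by
  rw [cond_apply hC.measurableSet, cond_apply hC.measurableSet, mul_left_comm]
  refine mul_le_mul_right ?_ _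
  have := Measure.addHaar_smul_of_nonneg (volume : Measure (Fin n → ℝ)) ht0.le
    (C ∩ {w | t • w ∈ S})
  rw [Module.finrank_fin_fun] at this
  rw [← this]
  refine measure_mono ?_
  rintro _ ⟨w, ⟨hwC, hwS⟩, rfl⟩
  exact ⟨hC.convex.smul_mem_of_zero_mem hC.zero_mem hwC ⟨ht0.le, ht1⟩, hwS⟩

lemma mul_preimage_smul_le_of_mem_hull {D : ProbabilityMeasure (Fin n → ℝ)}
    (hD : D ∈ symmetricUniformHull n) {t : ℝ} (ht0 : 0 < t) (ht1 : t ≤ 1) (S : Set (Fin n → ℝ)) :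
    ENNReal.ofReal (t ^ n) * (D : Measure (Fin n → ℝ)) {w | t • w ∈ S}
      ≤ (D : Measure (Fin n → ℝ)) S := by
  obtain ⟨r, c, C, hC, -, hDc⟩ := hD
  simp only [hDc, Measure.finsetSum_apply, Measure.smul_apply, Finset.mul_sum]
  refine Finset.sum_le_sum fun j _ => ?_
  rw [mul_smul_comm]
  gcongr
  exact (hC j).mul_cond_preimage_smul_le ht0 ht1 S

/-- The dilation bound passes to weak limits. It is tested on continuous functions first, then on
closed sets and measurable sets. -/
lemma IsCentralConvexUnimodal.smul_map_smul_le {D : ProbabilityMeasure (Fin n → ℝ)}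
    (hD : IsCentralConvexUnimodal D) {t : ℝ} (ht0 : 0 < t) (ht1 : t ≤ 1) :
    ENNReal.ofReal (t ^ n) • (D : Measure (Fin n → ℝ)).map (fun w => t • w)
      ≤ (D : Measure (Fin n → ℝ)) := by
  have hsm : Continuous fun w : Fin n → ℝ => t • w := continuous_const_smul t
  have hcont : ∀ φ : BoundedContinuousFunction (Fin n → ℝ) ℝ≥0,
      ENNReal.ofReal (t ^ n) * ∫⁻ w, φ (t • w) ∂(D : Measure (Fin n → ℝ))
        ≤ ∫⁻ w, φ w ∂(D : Measure (Fin n → ℝ)) := by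
    intro φ
    obtain ⟨Ds, hDs, hlim⟩ := hD.exists_seq
    rw [ProbabilityMeasure.tendsto_iff_forall_lintegral_tendsto] at hlim
    refine le_of_tendsto_of_tendsto' (ENNReal.Tendsto.const_mul
      (hlim (φ.compContinuous ⟨_, hsm⟩)) (Or.inr ENNReal.ofReal_ne_top)) (hlim φ) fun k => ?_
    have hle : ENNReal.ofReal (t ^ n) • (Ds k : Measure (Fin n → ℝ)).map (fun w => t • w)
        ≤ (Ds k : Measure (Fin n → ℝ)) := by
      refine Measure.le_iff.2 fun S hS => ?_
      rw [Measure.smul_apply, smul_eq_mul, Measure.map_apply hsm.measurable hS]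
      exact mul_preimage_smul_le_of_mem_hull (hDs k) ht0 ht1 S
    have := lintegral_mono' hle (le_refl fun w => (φ w : ENNReal))
    rwa [lintegral_smul_measure, lintegral_map (by fun_prop) hsm.measurable] at this
  have hclosed : ∀ F : Set (Fin n → ℝ), IsClosed F →
      ENNReal.ofReal (t ^ n) * (D : Measure (Fin n → ℝ)) {w | t • w ∈ F}
        ≤ (D : Measure (Fin n → ℝ)) F := by
    intro F hF
    have hlim := tendsto_lintegral_thickenedIndicator_of_isClosed (D : Measure (Fin n → ℝ)) hF
      (δs := fun k : ℕ => 1 / ((k : ℝ) + 1)) (fun k => Nat.one_div_pos_of_nat)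
      tendsto_one_div_add_atTop_nhds_zero_nat
    refine ge_of_tendsto' hlim fun k => le_trans ?_ (hcont _)
    refine mul_le_mul_right ?_ _
    have hFm : MeasurableSet {w : Fin n → ℝ | t • w ∈ F} := hsm.measurable hF.measurableSet
    rw [← lintegral_indicator_one hFm]
    refine lintegral_mono fun w => ?_
    by_cases hw : t • w ∈ F
    · rw [Set.indicator_of_mem (show w ∈ {w | t • w ∈ F} from hw),
        thickenedIndicator_one (Nat.one_div_pos_of_nat) F hw]
      simp
    · rw [Set.indicator_of_notMem (show w ∉ {w | t • w ∈ F} from hw)]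
      exact zero_le
  refine Measure.le_iff.2 fun S hS => ?_
  have : IsFiniteMeasure
      (ENNReal.ofReal (t ^ n) • (D : Measure (Fin n → ℝ)).map (fun w => t • w)) :=
    Measure.smul_finite _ ENNReal.ofReal_ne_top
  refine le_of_forall_lt fun r hr => ?_
  obtain ⟨F, hFS, hF, hrF⟩ := hS.exists_lt_isClosed_of_ne_top (measure_ne_top _ _) hr
  refine hrF.trans_le ?_
  rw [Measure.smul_apply, smul_eq_mul, Measure.map_apply hsm.measurable hF.measurableSet]
  exact (hclosed F hF).trans (measure_mono hFS)

/-! ### Anderson's inequality for symmetric convex sets -/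

/-- Measurable functions with values in `[0, 1]`. -/
structure IsMeasUnit (φ : (Fin n → ℝ) → ℝ) : Prop where
  measurable : Measurable φ
  nonneg : ∀ x, 0 ≤ φ x
  le_one : ∀ x, φ x ≤ 1

lemma IsLipUnit.isMeasUnit {φ : (Fin n → ℝ) → ℝ} (hφ : IsLipUnit φ) : IsMeasUnit φ :=
  ⟨hφ.continuous.measurable, hφ.nonneg, hφ.le_one⟩

lemma isMeasUnit_indicator {R : Set (Fin n → ℝ)} (hR : MeasurableSet R) :
    IsMeasUnit (R.indicator fun _ => 1) where
  measurable := measurable_const.indicator hR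
  nonneg := Set.indicator_nonneg fun _ _ => zero_le_one
  le_one := Set.indicator_le' (fun _ _ => le_rfl) fun _ _ => zero_le_one

variable (M : Matrix (Fin n) (Fin n) ℝ)

section

variable (D : Measure (Fin n → ℝ)) [IsProbabilityMeasure D] {φ ψ : (Fin n → ℝ) → ℝ}

lemma IsMeasUnit.integrable_section (hφ : IsMeasUnit φ) (y : Fin n → ℝ) :
    Integrable (fun w => φ (M *ᵥ y + w)) D :=
  integrable_of_unit_bounds (measurable_section M hφ.measurable y) (fun _ => hφ.nonneg _)
    (fun _ => hφ.le_one _)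

lemma IsMeasUnit.stepOp (hφ : IsMeasUnit φ) : IsMeasUnit (stepOp M D φ) where
  measurable := by
    have : Measurable fun p : (Fin n → ℝ) × (Fin n → ℝ) => φ (M *ᵥ p.1 + p.2) :=
      hφ.measurable.comp (continuous_mulVec_add M).measurable
    exact this.stronglyMeasurable.integral_prod_right'.measurable
  nonneg y := (integral_mem_unit (measurable_section M hφ.measurable y)
    (fun _ => hφ.nonneg _) (fun _ => hφ.le_one _)).1
  le_one y := (integral_mem_unit (measurable_section M hφ.measurable y)
    (fun _ => hφ.nonneg _) (fun _ => hφ.le_one _)).2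

lemma IsMeasUnit.iterate_stepOp (hφ : IsMeasUnit φ) (l : ℕ) :
    IsMeasUnit ((_root_.stepOp M D)^[l] φ) := by
  induction l with
  | zero => exact hφ
  | succ l ih => rw [Function.iterate_succ_apply']; exact ih.stepOp M D

lemma stepOp_mono (hφ : IsMeasUnit φ) (hψ : IsMeasUnit ψ) (h : ∀ x, φ x ≤ ψ x) (y : Fin n → ℝ) :
    stepOp M D φ y ≤ stepOp M D ψ y :=
  integral_mono (hφ.integrable_section M D y) (hψ.integrable_section M D y) fun _ => h _

lemma iterate_stepOp_mono (hφ : IsMeasUnit φ) (hψ : IsMeasUnit ψ) (h : ∀ x, φ x ≤ ψ x) (l : ℕ)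
    (y : Fin n → ℝ) : (stepOp M D)^[l] φ y ≤ (stepOp M D)^[l] ψ y := by
  induction l generalizing y with
  | zero => exact h y
  | succ l ih =>
    simp only [Function.iterate_succ_apply']
    exact stepOp_mono M D (hφ.iterate_stepOp M D l) (hψ.iterate_stepOp M D l) ih y

lemma tendsto_iterate_stepOp {φ : ℕ → (Fin n → ℝ) → ℝ} (hφ : ∀ k, IsMeasUnit (φ k))
    (hlim : ∀ x, Filter.Tendsto (fun k => φ k x) Filter.atTop (nhds (ψ x))) (l : ℕ)
    (y : Fin n → ℝ) :
    Filter.Tendsto (fun k => (stepOp M D)^[l] (φ k) y) Filter.atTop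
      (nhds ((stepOp M D)^[l] ψ y)) := by
  induction l generalizing y with
  | zero => exact hlim y
  | succ l ih =>
    simp only [Function.iterate_succ_apply']
    have h := fun k => (hφ k).iterate_stepOp M D l
    exact tendsto_stepOp M D (fun k => (h k).measurable) (fun k => (h k).nonneg)
      (fun k => (h k).le_one) ih y

end

variable {D : ProbabilityMeasure (Fin n → ℝ)} {R : Set (Fin n → ℝ)}

lemma AndersonClass.iterate_stepOp (hD : IsCentralConvexUnimodal D) {φ : (Fin n → ℝ) → ℝ}
    (hφ : AndersonClass φ) (l : ℕ) : AndersonClass ((_root_.stepOp M D)^[l] φ) := by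
  induction l with
  | zero => exact hφ
  | succ l ih => rw [Function.iterate_succ_apply']; exact ih.stepOp M hD

lemma IsCentralConvexUnimodal.mul_iterate_stepOp_le (hD : IsCentralConvexUnimodal D) {t : ℝ}
    (ht0 : 0 < t) (ht1 : t ≤ 1) {φ : (Fin n → ℝ) → ℝ} (hφ : IsMeasUnit φ) (l : ℕ)
    (y : Fin n → ℝ) :
    (t ^ n) ^ l * (stepOp M D)^[l] (fun x => φ (t • x)) y ≤ (stepOp M D)^[l] φ (t • y) := by
  have hsm : Measurable fun w : Fin n → ℝ => t • w := measurable_const_smul t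
  have hφt : IsMeasUnit fun x => φ (t • x) :=
    ⟨hφ.measurable.comp hsm, fun _ => hφ.nonneg _, fun _ => hφ.le_one _⟩
  induction l generalizing y with
  | zero => simp
  | succ l ih =>
    simp only [Function.iterate_succ_apply']
    set g := (stepOp M (D : Measure (Fin n → ℝ)))^[l] φ with hg
    set gt := (stepOp M (D : Measure (Fin n → ℝ)))^[l] (fun x => φ (t • x)) with hgt
    have hgu : IsMeasUnit g := hφ.iterate_stepOp M _ l
    have hgtu : IsMeasUnit gt := hφt.iterate_stepOp M _ l
    have hgs : Measurable fun w => g (M *ᵥ (t • y) + w) := measurable_section M hgu.measurable _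
    calc (t ^ n) ^ (l + 1) * stepOp M D gt y
        = t ^ n * ∫ w, (t ^ n) ^ l * gt (M *ᵥ y + w) ∂(D : Measure (Fin n → ℝ)) := by
          rw [integral_const_mul, stepOp]; ring
      _ ≤ t ^ n * ∫ w, g (M *ᵥ (t • y) + t • w) ∂(D : Measure (Fin n → ℝ)) := by
          refine mul_le_mul_of_nonneg_left ?_ (by positivity)
          refine integral_mono ((hgtu.integrable_section M _ y).const_mul _)
            (integrable_of_unit_bounds (hgs.comp hsm) (fun _ => hgu.nonneg _)
              fun _ => hgu.le_one _) fun w => ?_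
          have := ih (M *ᵥ y + w)
          rwa [smul_add, ← Matrix.mulVec_smul] at this
      _ = ∫ w, g (M *ᵥ (t • y) + w)
            ∂(ENNReal.ofReal (t ^ n) • (D : Measure (Fin n → ℝ)).map (fun w => t • w)) := by
          rw [integral_smul_measure, ENNReal.toReal_ofReal (by positivity), smul_eq_mul,
            integral_map hsm.aemeasurable hgs.aestronglyMeasurable]
      _ ≤ stepOp M D g (t • y) :=
          integral_mono_measure (hD.smul_map_smul_le ht0 ht1)
            (ae_of_all _ fun _ => hgu.nonneg _) (hgu.integrable_section M _ _)

/-- The origin lies in the relative interior of a symmetric convex set, so contracting the closure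
leads back into the set. -/
lemma smul_mem_of_mem_closure (hRc : Convex ℝ R) (hRs : IsSymmetricSet R) {x : Fin n → ℝ}
    (hx : x ∈ closure R) {t : ℝ} (ht0 : 0 < t) (ht1 : t < 1) : t • x ∈ R := by
  set V := Submodule.span ℝ R
  set R' : Set V := (↑) ⁻¹' R
  have hc : Convex ℝ R' := hRc.linear_preimage V.subtype
  have hsymm : ∀ x ∈ R', -x ∈ R' := fun x hx => hRs _ hx
  obtain ⟨p, hp⟩ : R.Nonempty := closure_nonempty_iff.1 ⟨x, hx⟩
  have hmid : ∀ {p : V}, p ∈ R' → (0 : V) ∈ R' := fun {p} hp => by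
    simpa using hc hp (hsymm p hp) (a := 2⁻¹) (b := 2⁻¹) (by norm_num) (by norm_num) (by norm_num)
  have h0 : (0 : V) ∈ R' := hmid (p := ⟨p, Submodule.subset_span hp⟩) hp
  have hint : (interior R').Nonempty := by
    rw [hc.interior_nonempty_iff_affineSpan_eq_top,
      AffineSubspace.affineSpan_eq_top_iff_vectorSpan_eq_top_of_nonempty ℝ V V ⟨0, h0⟩,
      vectorSpan_eq_span_vsub_set_right ℝ h0]
    simp only [vsub_eq_sub, sub_zero, Set.image_id']
    exact Submodule.span_span_coe_preimage
  have h0i : (0 : V) ∈ interior R' := by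
    obtain ⟨q, hq⟩ := hint
    have := hc.combo_interior_self_mem_interior hq (hsymm q (interior_subset hq))
      (a := 2⁻¹) (b := 2⁻¹) (by norm_num) (by norm_num) (by norm_num)
    simpa using this
  have hxV : x ∈ V := closure_minimal Submodule.subset_span
    (Submodule.closed_of_finiteDimensional V) hx
  have hx' : (⟨x, hxV⟩ : V) ∈ closure R' := by
    have himage : ((↑) : V → Fin n → ℝ) '' R' = R :=
      Set.image_preimage_eq_of_subset fun z hz => ⟨⟨z, Submodule.subset_span hz⟩, rfl⟩
    rw [closure_subtype, himage]
    exact hx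
  have := hc.combo_closure_interior_mem_interior hx' h0i (a := t) (b := 1 - t) ht0.le
    (by linarith) (by ring)
  rw [smul_zero, add_zero] at this
  have hmem : t • (⟨x, hxV⟩ : V) ∈ R' := interior_subset this
  exact hmem

/-- Iterated noise gives the boundary of a symmetric convex set no extra mass: compare the closure
with its contractions by `t < 1` and let `t → 1`. -/
lemma IsCentralConvexUnimodal.iterate_stepOp_closure_le (hD : IsCentralConvexUnimodal D)
    (hRm : MeasurableSet R) (hRc : Convex ℝ R) (hRs : IsSymmetricSet R) (l : ℕ) :
    (stepOp M D)^[l] ((closure R).indicator fun _ => 1) 0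
      ≤ (stepOp M D)^[l] (R.indicator fun _ => 1) 0 := by
  set a := (stepOp M (D : Measure (Fin n → ℝ)))^[l] ((closure R).indicator fun _ => 1) 0
  have hle : ∀ t ∈ Set.Ioo (0 : ℝ) 1,
      (t ^ n) ^ l * a ≤ (stepOp M D)^[l] (R.indicator fun _ => 1) 0 := by
    intro t ht
    have h1 := hD.mul_iterate_stepOp_le M ht.1 ht.2.le (isMeasUnit_indicator hRm) l 0
    rw [smul_zero] at h1
    refine le_trans (mul_le_mul_of_nonneg_left ?_ (pow_nonneg (pow_nonneg ht.1.le _) _)) h1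
    refine iterate_stepOp_mono M _ (isMeasUnit_indicator isClosed_closure.measurableSet)
      ⟨(isMeasUnit_indicator hRm).measurable.comp (measurable_const_smul t),
        fun _ => (isMeasUnit_indicator hRm).nonneg _, fun _ => (isMeasUnit_indicator hRm).le_one _⟩
      (fun x => ?_) l 0
    by_cases hx : x ∈ closure R
    · rw [Set.indicator_of_mem hx, Function.comp_apply,
        Set.indicator_of_mem (smul_mem_of_mem_closure hRc hRs hx ht.1 ht.2)]
    · rw [Set.indicator_of_notMem hx]
      exact (isMeasUnit_indicator hRm).nonneg _
  have hlim : Filter.Tendsto (fun t : ℝ => (t ^ n) ^ l * a) (nhdsWithin 1 (Set.Iio 1))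
      (nhds ((1 ^ n) ^ l * a)) :=
    ((by fun_prop : Continuous fun t : ℝ => (t ^ n) ^ l * a).tendsto 1).mono_left
      nhdsWithin_le_nhds
  have := le_of_tendsto hlim (Filter.mem_of_superset (Ioo_mem_nhdsLT zero_lt_one) hle)
  simpa using this

/-- The height of the tent of slope `k` over a nonempty set `R`; as `k → ∞` it decreases to the
indicator of the closure of `R`. -/
noncomputable def tent (R : Set (Fin n → ℝ)) (k : ℕ) (x : Fin n → ℝ) : ℝ :=
  max 0 (1 - k * Metric.infDist x R)

lemma tent_of_mem_closure (k : ℕ) {x : Fin n → ℝ} (hx : x ∈ closure R) : tent R k x = 1 := by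
  simp [tent, Metric.infDist_zero_of_mem_closure hx]

lemma tendsto_tent (hR0 : R.Nonempty) (x : Fin n → ℝ) :
    Filter.Tendsto (fun k => tent R k x) Filter.atTop
      (nhds ((closure R).indicator (fun _ => 1) x)) := by
  by_cases hx : x ∈ closure R
  · simp [tent_of_mem_closure _ hx, hx]
  · rw [Set.indicator_of_notMem hx]
    have hpos : 0 < Metric.infDist x R := (Metric.infDist_pos_iff_notMem_closure hR0).1 hx
    obtain ⟨N, hN⟩ := exists_nat_gt (1 / Metric.infDist x R)
    refine tendsto_const_nhds.congr' ?_
    filter_upwards [Filter.eventually_ge_atTop N] with k hk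
    have hk' : (N : ℝ) ≤ k := by exact_mod_cast hk
    rw [div_lt_iff₀ hpos] at hN
    rw [tent, max_eq_left]
    nlinarith

lemma Convex.infDist_midpoint_le (hRc : Convex ℝ R) (hR0 : R.Nonempty) (x y : Fin n → ℝ) :
    Metric.infDist ((2⁻¹ : ℝ) • (x + y)) R
      ≤ (Metric.infDist x R + Metric.infDist y R) / 2 := by
  refine le_of_forall_pos_le_add fun ε hε => ?_
  obtain ⟨p, hp, hxp⟩ := (Metric.infDist_lt_iff hR0).1 (lt_add_of_pos_right (Metric.infDist x R) hε)
  obtain ⟨q, hq, hyq⟩ := (Metric.infDist_lt_iff hR0).1 (lt_add_of_pos_right (Metric.infDist y R) hε)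
  have hpq : (2⁻¹ : ℝ) • (p + q) ∈ R := by
    rw [smul_add]; exact hRc hp hq (by norm_num) (by norm_num) (by norm_num)
  refine (Metric.infDist_le_dist_of_mem hpq).trans ?_
  rw [dist_smul₀, Real.norm_of_nonneg (by norm_num)]
  have := dist_add_add_le x y p q
  linarith

lemma andersonClass_tent (hRc : Convex ℝ R) (hRs : IsSymmetricSet R) (hR0 : R.Nonempty) (k : ℕ) :
    AndersonClass (tent R k) := by
  refine .base ⟨⟨k, ?_⟩, fun x => le_max_left _ _, fun x => ?_⟩ (fun x => ?_) fun x y => ?_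
  · refine LipschitzWith.const_max (LipschitzWith.of_dist_le_mul fun x y => ?_) 0
    rw [dist_sub_left, dist_eq_norm, ← mul_sub, norm_mul, ← dist_eq_norm]
    simpa using mul_le_mul_of_nonneg_left ((Metric.lipschitz_infDist_pt R).dist_le_mul x y)
      (Nat.cast_nonneg (α := ℝ) k)
  · exact max_le zero_le_one (by
      have := mul_nonneg (Nat.cast_nonneg (α := ℝ) k) (Metric.infDist_nonneg (x := x) (s := R))
      linarith)
  · have hneg : IsometryEquiv.neg (Fin n → ℝ) '' R = R := by
      ext z
      exact ⟨by rintro ⟨w, hw, rfl⟩; exact hRs w hw, fun hz => ⟨-z, hRs z hz, neg_neg z⟩⟩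
    have := Metric.infDist_image (IsometryEquiv.neg (Fin n → ℝ)).isometry (x := x) (t := R)
    rw [hneg] at this
    simp only [tent]
    rw [← this]
    rfl
  · have h := mul_le_mul_of_nonneg_left (hRc.infDist_midpoint_le hR0 x y)
      (Nat.cast_nonneg (α := ℝ) k)
    simp only [tent]
    set a := (k : ℝ) * Metric.infDist x R with ha
    set b := (k : ℝ) * Metric.infDist y R with hb
    set c := (k : ℝ) * Metric.infDist ((2⁻¹ : ℝ) • (x + y)) R
    have hc : c ≤ (a + b) / 2 := h.trans_eq (by rw [ha, hb]; ring)
    rcases le_total (1 - a) 0 with h1 | h1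
    · rw [max_eq_left h1, zero_mul]; positivity
    rcases le_total (1 - b) 0 with h2 | h2
    · rw [max_eq_left h2, mul_zero]; positivity
    rw [max_eq_right h1, max_eq_right h2, max_eq_right (by linarith)]
    nlinarith [sq_nonneg (a - b)]

/-- Anderson's inequality for the linear recursion: among all starting points, the origin gives a
symmetric convex set the largest probability of being hit after `l` steps. -/
theorem IsCentralConvexUnimodal.iterate_stepOp_le_zero (hD : IsCentralConvexUnimodal D)
    (hRm : MeasurableSet R) (hRc : Convex ℝ R) (hRs : IsSymmetricSet R) (l : ℕ) (y : Fin n → ℝ) :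
    (stepOp M D)^[l] (R.indicator fun _ => 1) y ≤ (stepOp M D)^[l] (R.indicator fun _ => 1) 0 := by
  rcases R.eq_empty_or_nonempty with rfl | hR0
  · -- the zero function is a fixed point of every step
    have : stepOp M (D : Measure (Fin n → ℝ)) (fun _ => 0) = fun _ => 0 := by
      ext y; simp [stepOp]
    simp [Function.iterate_fixed this]
  refine le_trans ?_ (hD.iterate_stepOp_closure_le M hRm hRc hRs l)
  have htent := fun k => andersonClass_tent hRc hRs hR0 k
  refine ge_of_tendsto' (tendsto_iterate_stepOp M D (fun k => (htent k).isLipUnit.isMeasUnit)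
    (tendsto_tent hR0) l 0) fun k => ?_
  refine le_trans ?_ (((htent k).iterate_stepOp M hD l).le_zero y)
  refine iterate_stepOp_mono M _ (isMeasUnit_indicator hRm) (htent k).isLipUnit.isMeasUnit
    (fun x => ?_) l y
  by_cases hx : x ∈ R
  · rw [Set.indicator_of_mem hx, tent_of_mem_closure k (subset_closure hx)]
  · rw [Set.indicator_of_notMem hx]
    exact (htent k).isLipUnit.nonneg x

end

/-! ### Errors with resets -/

section

variable {n : ℕ}

/-- A function of the disturbance sequence that depends on the disturbances before time `k` only. -/
def DependsOnPrefix {α : Type*} (k : ℕ) (h : (ℕ → Fin n → ℝ) → α) : Prop :=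
  ∀ w w', (∀ j < k, w j = w' j) → h w = h w'

variable {Ω : Type*} [MeasurableSpace Ω] {P : Measure Ω}
  {w : ℕ → Ω → Fin n → ℝ} {D : ProbabilityMeasure (Fin n → ℝ)}
  {M : Matrix (Fin n) (Fin n) ℝ}

lemma DependsOnPrefix.indepFun (hwm : ∀ k, Measurable (w k)) (hwind : iIndepFun w P) {k : ℕ}
    {h : (ℕ → Fin n → ℝ) → Fin n → ℝ} (hm : Measurable h) (hk : DependsOnPrefix k h) :
    IndepFun (fun ω => h fun j => w j ω) (w k) P := by
  have hind := hwind.indepFun_finset (Finset.range k) {k} (by simp) hwm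
  -- extend a finite prefix by zeros
  let ext : (Finset.range k → Fin n → ℝ) → ℕ → Fin n → ℝ :=
    fun q j => if hj : j ∈ Finset.range k then q ⟨j, hj⟩ else 0
  have hext : Measurable ext := by
    refine measurable_pi_iff.2 fun j => ?_
    by_cases hj : j ∈ Finset.range k
    · simpa only [ext, hj, dite_true] using measurable_pi_apply (⟨j, hj⟩ : Finset.range k)
    · simp only [ext, hj, dite_false, measurable_const]
  have hlast : Measurable fun q : (({k} : Finset ℕ) → Fin n → ℝ) =>
      q ⟨k, Finset.mem_singleton_self k⟩ := measurable_pi_apply _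
  have heq : (fun ω => h fun j => w j ω)
      = (h ∘ ext) ∘ fun ω (i : Finset.range k) => w i ω := by
    ext1 ω
    refine hk _ _ fun j hj => ?_
    simp [ext, hj]
  rw [heq]
  exact hind.comp (hm.comp hext) hlast

variable [IsProbabilityMeasure P]

/-- Averaging over the disturbance at time `k`, which is independent of the past. -/
lemma DependsOnPrefix.integral_step (hwm : ∀ k, Measurable (w k)) (hwind : iIndepFun w P)
    (hwlaw : ∀ k, P.map (w k) = (D : Measure (Fin n → ℝ))) {k : ℕ}
    {h : (ℕ → Fin n → ℝ) → Fin n → ℝ} (hm : Measurable h) (hk : DependsOnPrefix k h)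
    {φ : (Fin n → ℝ) → ℝ} (hφ : IsMeasUnit φ) :
    ∫ ω, φ (M *ᵥ h (fun j => w j ω) + w k ω) ∂P = ∫ ω, stepOp M D φ (h fun j => w j ω) ∂P := by
  have hX : Measurable fun ω => h fun j => w j ω := hm.comp (measurable_pi_iff.2 hwm)
  have hprod := (indepFun_iff_map_prod_eq_prod_map_map hX.aemeasurable (hwm k).aemeasurable).1
    (hk.indepFun hwm hwind hm)
  have hg : Measurable fun p : (Fin n → ℝ) × (Fin n → ℝ) => φ (M *ᵥ p.1 + p.2) :=
    hφ.measurable.comp (continuous_mulVec_add M).measurable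
  have := Measure.isProbabilityMeasure_map (μ := P) hX.aemeasurable
  calc ∫ ω, φ (M *ᵥ h (fun j => w j ω) + w k ω) ∂P
      = ∫ p, φ (M *ᵥ p.1 + p.2) ∂(P.map fun ω => (h fun j => w j ω, w k ω)) :=
        (integral_map (hX.prodMk (hwm k)).aemeasurable hg.aestronglyMeasurable).symm
    _ = ∫ y, stepOp M D φ y ∂(P.map fun ω => h fun j => w j ω) := by
        rw [hprod, hwlaw k, integral_prod]
        · rfl
        · exact integrable_of_unit_bounds hg (fun _ => hφ.nonneg _) fun _ => hφ.le_one _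
    _ = ∫ ω, stepOp M D φ (h fun j => w j ω) ∂P :=
        integral_map hX.aemeasurable (hφ.stepOp M _).measurable.aestronglyMeasurable

lemma measurable_linearError (k : ℕ) : Measurable fun w => linearError M w k := by
  induction k with
  | zero => exact measurable_const
  | succ k ih => exact (continuous_mulVec_add M).measurable.comp (ih.prodMk (measurable_pi_apply k))

lemma dependsOnPrefix_linearError (k : ℕ) : DependsOnPrefix k fun w => linearError M w k := by
  induction k with
  | zero => exact fun _ _ _ => rfl
  | succ k ih =>
    intro w w' h
    simp only [linearError]
    rw [show linearError M w k = linearError M w' k from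
      ih w w' fun j hj => h j (hj.trans k.lt_succ_self), h k k.lt_succ_self]

lemma integral_iterate_stepOp_linearError (hwm : ∀ k, Measurable (w k)) (hwind : iIndepFun w P)
    (hwlaw : ∀ k, P.map (w k) = (D : Measure (Fin n → ℝ))) {φ : (Fin n → ℝ) → ℝ}
    (hφ : IsMeasUnit φ) (k l : ℕ) :
    ∫ ω, (stepOp M D)^[l] φ (linearError M (fun j => w j ω) k) ∂P
      = (stepOp M D)^[k + l] φ 0 := by
  induction k generalizing l with
  | zero => simp [linearError]
  | succ k ih =>
    simp only [linearError]
    rw [(dependsOnPrefix_linearError k).integral_step hwm hwind hwlaw (measurable_linearError k)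
      (hφ.iterate_stepOp M _ l),
      ← Function.iterate_succ_apply' (stepOp M (D : Measure (Fin n → ℝ))), ih, Nat.succ_eq_add_one, show k + (l + 1) = k + 1 + l by omega]

lemma IsPRS.le_iterate_stepOp (hwm : ∀ k, Measurable (w k)) (hwind : iIndepFun w P)
    (hwlaw : ∀ k, P.map (w k) = (D : Measure (Fin n → ℝ))) {p : ℝ} {R : Set (Fin n → ℝ)}
    (hRm : MeasurableSet R) (hR : IsPRS M D p R) (k : ℕ) :
    p ≤ (stepOp M D)^[k] (R.indicator fun _ => 1) 0 := by
  have hmap := hwind.map_fun_eq_infinitePi_map hwm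
  simp only [hwlaw] at hmap
  have hset : MeasurableSet {w | linearError M w k ∈ R} := measurable_linearError k hRm
  refine (hR k).trans_eq ?_
  have h := integral_iterate_stepOp_linearError (M := M) hwm hwind hwlaw
    (isMeasUnit_indicator hRm) k 0
  rw [add_zero] at h
  rw [← h, ← hmap, map_measureReal_apply (measurable_pi_iff.2 hwm) hset,
    ← integral_indicator_one (measurable_pi_iff.2 hwm hset)]
  rfl

/-- An error that follows `e ↦ M e + w` but may at any time, as a function of the past, be reset to
zero hits a symmetric convex probabilistic reachable set with at least the prescribed
probability: by Anderson's inequality each reset only raises the probability of being in the set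
at time `k` if no reset follows. -/
theorem IsPRS.le_measureReal_of_reset (hwm : ∀ k, Measurable (w k)) (hwind : iIndepFun w P)
    (hwlaw : ∀ k, P.map (w k) = (D : Measure (Fin n → ℝ))) (hD : IsCentralConvexUnimodal D)
    {p : ℝ} {R : Set (Fin n → ℝ)} (hRm : MeasurableSet R) (hRc : Convex ℝ R)
    (hRs : IsSymmetricSet R) (hR : IsPRS M D p R) {err : ℕ → (ℕ → Fin n → ℝ) → Fin n → ℝ}
    (hm : ∀ k, Measurable (err k)) (hdep : ∀ k, DependsOnPrefix k (err k))
    (hzero : ∀ w, err 0 w = 0)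
    (hsucc : ∀ k w, err (k + 1) w = 0 ∨ err (k + 1) w = M *ᵥ err k w + w k) (k : ℕ) :
    p ≤ P.real {ω | err k (fun j => w j ω) ∈ R} := by
  set φ : (Fin n → ℝ) → ℝ := R.indicator fun _ => 1
  have hφ : IsMeasUnit φ := isMeasUnit_indicator hRm
  have hW : Measurable fun ω j => w j ω := measurable_pi_iff.2 hwm
  -- the probability of `R` at time `k + l` if no reset happens after time `k`, against the error
  -- that is never reset
  have key : ∀ k l, (stepOp M D)^[k + l] φ 0
      ≤ ∫ ω, (stepOp M D)^[l] φ (err k fun j => w j ω) ∂P := by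
    intro k
    induction k with
    | zero => intro l; simp [hzero]
    | succ k ih =>
      intro l
      have hu := hφ.iterate_stepOp M (D : Measure (Fin n → ℝ)) l
      have h1 := ih (l + 1)
      rw [Function.iterate_succ_apply', ← (hdep k).integral_step hwm hwind hwlaw (hm k) hu,
        show k + (l + 1) = k + 1 + l by omega] at h1
      refine h1.trans (integral_mono
        (integrable_of_unit_bounds ?_ (fun _ => hu.nonneg _) fun _ => hu.le_one _)
        (integrable_of_unit_bounds (hu.measurable.comp ((hm (k + 1)).comp hW))
          (fun _ => hu.nonneg _) fun _ => hu.le_one _) fun ω => ?_)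
      · exact hu.measurable.comp ((continuous_mulVec_add M).measurable.comp
          (((hm k).comp hW).prodMk (hwm k)))
      · rcases hsucc k fun j => w j ω with h | h
        · simp only [h]
          exact hD.iterate_stepOp_le_zero M hRm hRc hRs l _
        · simp only [h, le_refl]
  refine (hR.le_iterate_stepOp hwm hwind hwlaw hRm k).trans ((key k 0).trans_eq ?_)
  exact integral_indicator_one (((hm k).comp hW) hRm)

end

/-! ### The closed loop: recursive feasibility and measurability -/

namespace SMPC

variable {n m : ℕ} {S : SMPC n m}

/-- Recursive feasibility: shift a feasible solution by one step and append the terminal control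
law. -/
lemma IsFeasible.shift (hterm : S.TerminalConditions) (hN : 1 ≤ S.N) {z : Fin n → ℝ}
    {zs : ℕ → Fin n → ℝ} {vs : ℕ → Fin m → ℝ} (h : S.IsFeasible z zs vs) :
    S.A *ᵥ z + S.B *ᵥ vs 0 ∈ S.feasibleSet := by
  refine ⟨fun i => if i < S.N then zs (i + 1) else S.A *ᵥ zs S.N + S.B *ᵥ (S.K *ᵥ zs S.N),
    fun i => if i + 1 < S.N then vs (i + 1) else S.K *ᵥ zs S.N, ?_, ?_, ?_, ?_, ?_⟩
  · simp only [show 0 < S.N by omega, if_true]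
    rw [h.dyn 0 (by omega), h.init]
  · intro i hi
    by_cases hi' : i + 1 < S.N
    · simp only [hi, hi', if_true, h.dyn (i + 1) hi']
    · have hiN : i + 1 = S.N := by omega
      simp only [hi, if_true, hiN, lt_irrefl, if_false]
  · intro i hi
    simp only [hi, if_true]
    by_cases hi' : i + 1 < S.N
    · exact h.state_mem _ hi'
    · rw [show i + 1 = S.N by omega]
      exact hterm.subset_Z h.terminal_mem
  · intro i hi
    by_cases hi' : i + 1 < S.N
    · simpa only [hi', if_true] using h.input_mem _ hi'
    · simpa only [hi', if_false] using hterm.input_mem _ h.terminal_mem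
  · simpa only [lt_irrefl, if_false] using hterm.invariant _ h.terminal_mem

variable {v₀ : (Fin n → ℝ) → Fin m → ℝ} {x₀ : Fin n → ℝ}

lemma z_mem_feasibleSet (hterm : S.TerminalConditions) (hN : 1 ≤ S.N) (hv₀ : S.IsMPCLaw v₀)
    (hx₀ : x₀ ∈ S.feasibleSet) (w : ℕ → Fin n → ℝ) (k : ℕ) :
    S.z v₀ x₀ w k ∈ S.feasibleSet := by
  induction k with
  | zero => exact hx₀
  | succ k ih =>
    obtain ⟨zs, vs, hopt, hv⟩ := hv₀ _ ih
    have hshift := hopt.1.shift hterm hN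
    rw [← hv] at hshift
    rw [z, closedLoop]
    dsimp only
    split_ifs with hx
    · exact hx
    · exact hshift

lemma z_mem_Z_and_v_mem_V (hterm : S.TerminalConditions) (hN : 1 ≤ S.N) (hv₀ : S.IsMPCLaw v₀)
    (hx₀ : x₀ ∈ S.feasibleSet) (w : ℕ → Fin n → ℝ) (k : ℕ) :
    S.z v₀ x₀ w k ∈ S.Z ∧ S.v v₀ x₀ w k ∈ S.V := by
  obtain ⟨zs, vs, hopt, hv⟩ := hv₀ _ (z_mem_feasibleSet hterm hN hv₀ hx₀ w k)
  refine ⟨?_, ?_⟩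
  · rw [← hopt.1.init]
    exact hopt.1.state_mem 0 hN
  · rw [v, hv]
    exact hopt.1.input_mem 0 hN

lemma e_succ (w : ℕ → Fin n → ℝ) (k : ℕ) :
    S.e v₀ x₀ w (k + 1) = 0 ∨ S.e v₀ x₀ w (k + 1) = S.AK *ᵥ S.e v₀ x₀ w k + w k := by
  simp only [e, x, z]
  rw [closedLoop]
  dsimp only
  split_ifs with h
  · exact Or.inl (sub_self _)
  · refine Or.inr ?_
    simp only [AK, Matrix.add_mulVec, Matrix.mulVec_sub, Matrix.mulVec_add, Matrix.mulVec_mulVec]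
    abel

lemma dependsOnPrefix_closedLoop (k : ℕ) :
    DependsOnPrefix k fun w => S.closedLoop v₀ x₀ w k := by
  induction k with
  | zero => exact fun _ _ _ => rfl
  | succ k ih =>
    intro w w' h
    simp only [closedLoop]
    rw [show S.closedLoop v₀ x₀ w k = S.closedLoop v₀ x₀ w' k from
      ih w w' fun j hj => h j (hj.trans k.lt_succ_self), h k k.lt_succ_self]

lemma measurable_closedLoop (hv₀m : Measurable v₀) (hfeasm : MeasurableSet S.feasibleSet) (k : ℕ) :
    Measurable fun w => S.closedLoop v₀ x₀ w k := by
  have hmul : ∀ {a b : ℕ} (T : Matrix (Fin a) (Fin b) ℝ), Measurable fun y => T *ᵥ y :=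
    fun T => (Matrix.mulVecLin T).continuous_of_finiteDimensional.measurable
  induction k with
  | zero => exact measurable_const
  | succ k ih =>
    have hz := ih.snd
    have hv := hv₀m.comp hz
    have hx' : Measurable fun w : ℕ → Fin n → ℝ =>
        S.A *ᵥ (S.closedLoop v₀ x₀ w k).1 + S.B *ᵥ (v₀ (S.closedLoop v₀ x₀ w k).2
          + S.K *ᵥ ((S.closedLoop v₀ x₀ w k).1 - (S.closedLoop v₀ x₀ w k).2)) + w k :=
      (((hmul S.A).comp ih.fst).add ((hmul S.B).comp
        (hv.add ((hmul S.K).comp (ih.fst.sub hz))))).add (measurable_pi_apply k)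
    simp only [closedLoop]
    exact hx'.prodMk (Measurable.ite (hx' hfeasm) hx'
      (((hmul S.A).comp hz).add ((hmul S.B).comp hv)))

end SMPC

theorem mainTheorem2 {n m : ℕ} (S : SMPC n m)
    (hN : 1 ≤ S.N) (hQ : S.Q.PosDef) (hQf : S.Qf.PosDef) (hR : S.R.PosDef)
    (hX : Convex ℝ S.X) (hX0 : 0 ∈ S.X) (hU : Convex ℝ S.U) (hU0 : 0 ∈ S.U)
    (hterm : S.TerminalConditions)
    (D : ProbabilityMeasure (Fin n → ℝ)) (hD : IsCentralConvexUnimodal D)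
    (px pu : ℝ)
    (hRxm : MeasurableSet S.Rx) (hRxc : Convex ℝ S.Rx) (hRxs : IsSymmetricSet S.Rx)
    (hRx : IsPRS S.AK D px S.Rx)
    (hRum : MeasurableSet S.Ru) (hRuc : Convex ℝ S.Ru) (hRus : IsSymmetricSet S.Ru)
    (hRu : IsPRS S.AK D pu S.Ru)
    (v₀ : (Fin n → ℝ) → Fin m → ℝ) (hv₀ : S.IsMPCLaw v₀) (hv₀m : Measurable v₀)
    (hfeasm : MeasurableSet S.feasibleSet)
    (x₀ : Fin n → ℝ) (hx₀ : x₀ ∈ S.feasibleSet)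
    {Ω : Type*} [MeasurableSpace Ω] (P : Measure Ω) [IsProbabilityMeasure P]
    (w : ℕ → Ω → Fin n → ℝ) (hwm : ∀ k, Measurable (w k)) (hwind : iIndepFun w P)
    (hwlaw : ∀ k, P.map (w k) = (D : Measure (Fin n → ℝ))) :
    ∀ k : ℕ,
      (∀ ω, S.z v₀ x₀ (fun j => w j ω) k ∈ S.Z ∧ S.v v₀ x₀ (fun j => w j ω) k ∈ S.V) ∧
      px ≤ P.real {ω | S.x v₀ x₀ (fun j => w j ω) k ∈ S.X} ∧
      pu ≤ P.real {ω | S.u v₀ x₀ (fun j => w j ω) k ∈ S.U} := by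
  have hmem := S.z_mem_Z_and_v_mem_V hterm hN hv₀ hx₀
  have hloop := fun k => SMPC.measurable_closedLoop (x₀ := x₀) hv₀m hfeasm k
  have herr : ∀ (p : ℝ) (R : Set (Fin n → ℝ)), MeasurableSet R → Convex ℝ R → IsSymmetricSet R →
      IsPRS S.AK D p R → ∀ k, p ≤ P.real {ω | S.e v₀ x₀ (fun j => w j ω) k ∈ R} :=
    fun p R hRm hRc hRs hR k =>
      hR.le_measureReal_of_reset (err := fun k w => S.e v₀ x₀ w k) hwm hwind hwlaw hD hRm hRc hRs
        (fun k => (hloop k).fst.sub (hloop k).snd)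
        (fun k w w' h => by
          simp only [SMPC.e, SMPC.x, SMPC.z]
          rw [show S.closedLoop v₀ x₀ w k = S.closedLoop v₀ x₀ w' k from
            SMPC.dependsOnPrefix_closedLoop k w w' h])
        (fun w => sub_self x₀) (fun k w => SMPC.e_succ w k) k
  intro k
  refine ⟨fun ω => hmem _ k, ?_, ?_⟩
  · refine (herr px S.Rx hRxm hRxc hRxs hRx k).trans (measureReal_mono fun ω he => ?_)
    have := (hmem (fun j => w j ω) k).1.2 _ he
    rwa [SMPC.e, add_sub_cancel] at this
  · refine (herr pu S.Ru hRum hRuc hRus hRu k).trans (measureReal_mono fun ω he => ?_)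
    exact (hmem (fun j => w j ω) k).2.2 _ ⟨_, he, rfl⟩
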